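/- **Setting.** Let $X$ be a finite-dimensional real inner product space with induced norm $\|\cdot\|$, and let $B:X\rightrightarrows X$ be a maximal monotone set-valued operator with $B^{-1}(0)=\{x : 0\in B(x)\}\neq\emptyset$. For $\varepsilon\ge 0$ let $$B^{[\varepsilon]}(y)=\{v\in X:\ \langle v-v',\,y-y'\rangle\ge-\varepsilon\ \text{ whenever } v'\in B(y')\}.$$ For $x_0\in X$ let $d_0$ be the distance from $x_0$ to $B^{-1}(0)$. Put $\log^+(t)=\max\{\log t,0\}$ for $t>0$ and $\log^+(0)=0$. **Algorithm 2** (static $\mu$-regularized HPE method). Input: $x_0\in X$, $\sigma\in[0,1)$, and real numbers $\mu,\rho,\varepsilon>0$. At iteration $k=1,2,\dots$, given the current point $x_{k-1}$: 1. choose any $\lambda_k>0$ and find any $(y_k,b_k,\varepsilon_k)\in X\times X\times[0,\infty)$ such that $$b_k\in B^{[\varepsilon_k]}(y_k),\qquad \big\|\lambda_k[b_k+\mu(y_k-x_0)]+y_k-x_{k-1}\big\|^2+2\lambda_k\varepsilon_k\le\sigma^2\|y_k-x_{k-1}\|^2;$$ 2. if $\|b_k+\mu(y_k-x_0)\|\le\rho$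 and $\varepsilon_k\le\varepsilon$, stop and output $(y_k,b_k,\varepsilon_k)$; otherwise set $x_k=x_{k-1}-\lambda_k[b_k+\mu(y_k-x_0)]$ and go to iteration $k+1$. **Theorem 3.3.** Let $\bar\rho,\bar\varepsilon>0$, $\rho\in(0,\bar\rho)$, $\mathcal D_0>0$, $x_0\in X$ and $\sigma\in[0,1)$. Consider any execution of Algorithm 2 with input $(x_0,\sigma,\mu,\rho,\varepsilon)$, where $$\mu=\frac{\bar\rho-\rho}{\left[1+\frac1{\sqrt{1-\sigma^2}}\right]\mathcal D_0},\qquad \varepsilon=\bar\varepsilon,$$ and suppose that $\lambda_k\ge\underline\lambda$ at every iteration $k$ performed, for some constant $\underline\lambda>0$. Then the following hold. (a) The algorithm terminates in at most $$\left(\frac{\left[1+1/\sqrt{1-\sigma^2}\right]\mathcal D_0}{2\underline\lambda(\bar\rho-\rho)}+\frac1{1-\sigma^2}\right)\left[2+\max\left\{\log^+\!\left(\left[\frac{1+\sigma}{1-\sigma}\right]\frac{d_0^2}{\underline\lambda^2\rho^2}\right),\ \log^+\!\left(\frac{\sigma^2d_0^2}{2(1-\sigma^2)\underline\lambda\bar\varepsilon}\right)\right\}\right]$$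 iterations. (b) If $\mathcal D_0\ge d_0$, then the algorithm terminates with a triple $(y_k,b_k,\varepsilon_k)$ satisfying $$b_k\in B^{[\varepsilon_k]}(y_k),\qquad \|b_k\|\le\bar\rho,\qquad \varepsilon_k\le\bar\varepsilon,\qquad \mu\|y_k-x_0\|\le\bar\rho-\rho.$$ -/

import Mathlib

namespace RegHPE

/-- The graph `{(x, v) | v ∈ A(x)}` of a set-valued operator. -/
def graph {X : Type*} (A : X → Set X) : Set (X × X) :=
  {p | p.2 ∈ A p.1}

/-- Monotonicity of a set-valued operator. -/
def IsMonotone {X : Type*} [NormedAddCommGroup X] [InnerProductSpace ℝ X]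
    (A : X → Set X) : Prop :=
  ∀ p ∈ graph A, ∀ q ∈ graph A, 0 ≤ inner ℝ (p.2 - q.2) (p.1 - q.1)

/-- A monotone operator whose graph is not properly contained in the graph of another
monotone operator. -/
def IsMaximalMonotone {X : Type*} [NormedAddCommGroup X] [InnerProductSpace ℝ X]
    (A : X → Set X) : Prop :=
  IsMonotone A ∧ ∀ B : X → Set X, IsMonotone B → graph A ⊆ graph B → A = B

/-- The `ε`-enlargement `B^{[ε]}(x)`. -/
def enlargement {X : Type*} [NormedAddCommGroup X] [InnerProductSpace ℝ X]
    (B : X → Set X) (ε : ℝ) (x : X) : Set X :=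
  {v | ∀ q ∈ graph B, -ε ≤ inner ℝ (v - q.2) (x - q.1)}

/-- The solution set `B⁻¹(0)` of the inclusion `0 ∈ B(x)`. -/
def zeros {X : Type*} [Zero X] (B : X → Set X) : Set X :=
  {x | (0 : X) ∈ B x}

/-- What one asks of `lam` and `(y, b, e)` in step 1 of the static `μ`-regularized HPE method,
when the current point is `x`. -/
structure StepOne {X : Type*} [NormedAddCommGroup X] [InnerProductSpace ℝ X]
    (B : X → Set X) (x₀ : X) (σ μ : ℝ) (x : X) (lam : ℝ) (y b : X) (e : ℝ) : Prop where
  lam_pos : 0 < lam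
  e_nonneg : 0 ≤ e
  mem : b ∈ enlargement B e y
  error : ‖lam • (b + μ • (y - x₀)) + y - x‖ ^ 2 + 2 * lam * e ≤ σ ^ 2 * ‖y - x‖ ^ 2

/-- The stopping test in step 2, applied to the triple `(y, b, e)`. -/
def StopTest {X : Type*} [NormedAddCommGroup X] [InnerProductSpace ℝ X]
    (x₀ : X) (μ ρ ε : ℝ) (y b : X) (e : ℝ) : Prop :=
  ‖b + μ • (y - x₀)‖ ≤ ρ ∧ e ≤ ε

/-- An execution of the static `μ`-regularized HPE method with input `(x₀, σ, μ, ρ, ε)`.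
Iterations are numbered `k = 1, 2, …`. The method demands something at iteration `k` only if
it has not stopped at an earlier iteration; entries of the sequences beyond the iteration at
which the method stops (and the entries of `lam`, `y`, `b`, `eps` at `0`) are arbitrary. -/
structure Execution {X : Type*} [NormedAddCommGroup X] [InnerProductSpace ℝ X]
    (B : X → Set X) (x₀ : X) (σ μ ρ ε : ℝ) where
  x : ℕ → X
  lam : ℕ → ℝ
  y : ℕ → X
  b : ℕ → X
  eps : ℕ → ℝ
  x_zero : x 0 = x₀
  step_one : ∀ k, 1 ≤ k → (∀ j, 1 ≤ j → j < k → ¬ StopTest x₀ μ ρ ε (y j) (b j) (eps j)) →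
    StepOne B x₀ σ μ (x (k - 1)) (lam k) (y k) (b k) (eps k)
  step_two : ∀ k, 1 ≤ k → (∀ j, 1 ≤ j → j ≤ k → ¬ StopTest x₀ μ ρ ε (y j) (b j) (eps j)) →
    x k = x (k - 1) - lam k • (b k + μ • (y k - x₀))

/-- The execution performs iteration `k`: it has not stopped at an earlier one. -/
def Execution.Performs {X : Type*} [NormedAddCommGroup X] [InnerProductSpace ℝ X]
    {B : X → Set X} {x₀ : X} {σ μ ρ ε : ℝ} (E : Execution B x₀ σ μ ρ ε) (k : ℕ) : Prop :=
  1 ≤ k ∧ ∀ j, 1 ≤ j → j < k → ¬ StopTest x₀ μ ρ ε (E.y j) (E.b j) (E.eps j)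

/-- The execution stops at iteration `k` (hence after exactly `k` iterations), and its output
is `(y k, b k, eps k)`. -/
def Execution.StopsAt {X : Type*} [NormedAddCommGroup X] [InnerProductSpace ℝ X]
    {B : X → Set X} {x₀ : X} {σ μ ρ ε : ℝ} (E : Execution B x₀ σ μ ρ ε) (k : ℕ) : Prop :=
  E.Performs k ∧ StopTest x₀ μ ρ ε (E.y k) (E.b k) (E.eps k)

/-- The regularization parameter `μ(D₀, ρ) = (ρ̄ - ρ) / ([1 + 1/√(1-σ²)] D₀)`. -/
noncomputable def regParam (σ ρbar ρ D₀ : ℝ) : ℝ :=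
  (ρbar - ρ) / ((1 + 1 / Real.sqrt (1 - σ ^ 2)) * D₀)

end RegHPE

/-! The regularized operator `B + μ(· - x₀)` has a zero `z` by Minty's theorem, and monotonicity
puts `z` within `d₀` of `x₀`. Strong monotonicity at `z` and the relative error criterion give the
one-step inequality `StepOne.energy_le`. Its two dissipation terms control `‖x - z‖²`, so each step
contracts the squared distance to `z` by the factor `1 - 1/T`, where `T = 1/(2λμ) + 1/(1-σ²)` and
`λ` is the lower bound on the stepsizes (`StepOne.contraction`). Residual and `e` are bounded by
multiples of `‖x - z‖²`, so the stopping test must pass after about `T` times a logarithm.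

For (b), every `y` stays within `(1 + 1/√(1-σ²)) d₀` of `x₀`; `μ` is scaled so that the
regularization term then costs at most `ρbar - ρ`. -/

namespace RegHPE

/-! ### Existence of a zero of the regularized operator. -/

section Minty

variable {X : Type*} [NormedAddCommGroup X] [InnerProductSpace ℝ X]

/-- The only non-affine part is `μ‖x‖²`, so the convexity defect is `s t μ ‖p - q‖²`. -/
theorem convexOn_inner_add_smul_sub {μ : ℝ} (hμ : 0 ≤ μ) (w y v : X) :
    ConvexOn ℝ Set.univ fun x : X => inner ℝ (v + μ • (x - w)) (x - y) := by
  refine ⟨convex_univ, fun p _ q _ s t hs ht hst => ?_⟩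
  have key : s * inner ℝ (v + μ • (p - w)) (p - y) + t * inner ℝ (v + μ • (q - w)) (q - y)
      - inner ℝ (v + μ • (s • p + t • q - w)) (s • p + t • q - y)
      = s * t * μ * inner ℝ (p - q) (p - q) := by
    obtain rfl : s = 1 - t := by linarith
    simp only [inner_add_left, inner_sub_left, inner_smul_left, inner_add_right, inner_sub_right,
      inner_smul_right, real_inner_comm, RCLike.conj_to_real]
    rw [real_inner_comm q p]
    ring
  have h0 : 0 ≤ s * t * μ * inner ℝ (p - q) (p - q) :=
    mul_nonneg (by positivity) real_inner_self_nonneg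
  simp only [smul_eq_mul]
  linarith

/-- The barycentre of finitely many points of a monotone graph gives a nonpositive average. -/
theorem sum_inner_centerMass_nonpos {ι : Type*} [Fintype ι] {y v : ι → X}
    (hyv : ∀ i j, 0 ≤ inner ℝ (v i - v j) (y i - y j)) (w : X) (μ : ℝ) {c : ι → ℝ}
    (hc : ∀ i, 0 ≤ c i) (hc1 : ∑ i, c i = 1) :
    ∑ i, c i * inner ℝ (v i + μ • ((∑ j, c j • y j) - w)) ((∑ j, c j • y j) - y i) ≤ 0 := by
  set z := ∑ j, c j • y j with hz
  have hzero : ∑ i, c i * inner ℝ (z - w) (z - y i) = 0 := by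
    have h : ∑ i, c i • (z - y i) = 0 := by
      simp only [smul_sub, Finset.sum_sub_distrib, ← Finset.sum_smul, hc1, one_smul, ← hz, sub_self]
    calc ∑ i, c i * inner ℝ (z - w) (z - y i) = inner ℝ (z - w) (∑ i, c i • (z - y i)) := by
          simp only [inner_sum, inner_smul_right]
      _ = 0 := by rw [h, inner_zero_right]
  -- Symmetrizing this double sum in `i` and `j` turns it into minus a sum of monotonicity terms.
  have hdouble : ∑ i, c i * inner ℝ (v i) (z - y i)
      = ∑ i, ∑ j, c i * c j * inner ℝ (v i) (y j - y i) := by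
    refine Finset.sum_congr rfl fun i _ => ?_
    have h : z - y i = ∑ j, c j • (y j - y i) := by
      simp only [smul_sub, Finset.sum_sub_distrib, ← Finset.sum_smul, hc1, one_smul, ← hz]
    rw [h, inner_sum, Finset.mul_sum]
    exact Finset.sum_congr rfl fun j _ => by rw [inner_smul_right]; ring
  have hswap : ∑ i, ∑ j, c i * c j * inner ℝ (v i) (y j - y i)
      = ∑ i, ∑ j, c i * c j * inner ℝ (v j) (y i - y j) := by
    rw [Finset.sum_comm]
    exact Finset.sum_congr rfl fun i _ => Finset.sum_congr rfl fun j _ => by ring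
  have hneg : ∑ i, ∑ j, c i * c j * inner ℝ (v i) (y j - y i)
      + ∑ i, ∑ j, c i * c j * inner ℝ (v j) (y i - y j) ≤ 0 := by
    rw [← Finset.sum_add_distrib]
    refine Finset.sum_nonpos fun i _ => ?_
    rw [← Finset.sum_add_distrib]
    refine Finset.sum_nonpos fun j _ => ?_
    have h1 := mul_nonneg (mul_nonneg (hc i) (hc j)) (hyv i j)
    have h2 : c i * c j * inner ℝ (v i) (y j - y i) + c i * c j * inner ℝ (v j) (y i - y j)
        = -(c i * c j * inner ℝ (v i - v j) (y i - y j)) := by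
      simp only [inner_sub_left, inner_sub_right]
      ring
    linarith
  have hsplit : ∑ i, c i * inner ℝ (v i + μ • (z - w)) (z - y i)
      = ∑ i, c i * inner ℝ (v i) (z - y i) + μ * ∑ i, c i * inner ℝ (z - w) (z - y i) := by
    rw [Finset.mul_sum, ← Finset.sum_add_distrib]
    refine Finset.sum_congr rfl fun i _ => ?_
    rw [inner_add_left, real_inner_smul_left]
    ring
  rw [hsplit, hzero, hdouble]
  linarith

/-- Approximate form of the Debrunner–Flor lemma for finitely many points. -/
theorem exists_forall_inner_lt {ι : Type*} [Fintype ι] {y v : ι → X}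
    (hyv : ∀ i j, 0 ≤ inner ℝ (v i - v j) (y i - y j)) (w : X) {μ δ : ℝ} (hμ : 0 ≤ μ)
    (hδ : 0 < δ) : ∃ x : X, ∀ i, inner ℝ (v i + μ • (x - w)) (x - y i) < δ := by
  classical
  by_contra! hno
  let f : ι → X → ℝ := fun i x => inner ℝ (v i + μ • (x - w)) (x - y i)
  let U : Set (ι → ℝ) := Set.univ.pi fun _ => Set.Iio δ
  -- Taking all vectors above the values of `f` makes `S` convex and forces the separating
  -- functional to have nonnegative coefficients. Normalized, these are the weights of a barycentre
  -- that contradicts the separation.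
  let S : Set (ι → ℝ) := {t | ∃ x, ∀ i, f i x ≤ t i}
  have hUconv : Convex ℝ U := convex_pi fun _ _ => convex_Iio δ
  have hUopen : IsOpen U := isOpen_set_pi Set.finite_univ fun _ _ => isOpen_Iio
  have hSconv : Convex ℝ S := by
    rintro t ⟨p, hp⟩ t' ⟨q, hq⟩ a b ha hb hab
    refine ⟨a • p + b • q, fun i => ?_⟩
    refine ((convexOn_inner_add_smul_sub hμ w (y i) (v i)).2 (Set.mem_univ p) (Set.mem_univ q)
      ha hb hab).trans ?_
    exact add_le_add (mul_le_mul_of_nonneg_left (hp i) ha) (mul_le_mul_of_nonneg_left (hq i) hb)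
  have hdisj : Disjoint U S := by
    rw [Set.disjoint_left]
    rintro t htU ⟨x, hx⟩
    obtain ⟨i, hi⟩ := hno x
    exact absurd (htU i (Set.mem_univ i)) (not_lt.mpr (hi.trans (hx i)))
  obtain ⟨g, u, hgU, hgS⟩ := geometric_hahn_banach_open hUconv hUopen hSconv hdisj
  let c : ι → ℝ := fun i => g (Pi.single i 1)
  have hg : ∀ t, g t = ∑ i, t i * c i := fun t => by
    conv_lhs => rw [pi_eq_sum_univ' t]
    simp [c, map_sum, Pi.single]
  have hc : ∀ i, 0 ≤ c i := by
    intro i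
    by_contra! hneg
    have hmem : ∀ s : ℝ, 0 ≤ s → (fun j => f j 0) + s • Pi.single i 1 ∈ S := fun s hs =>
      ⟨0, fun j => by
        have : 0 ≤ s * (Pi.single i 1 : ι → ℝ) j :=
          mul_nonneg hs (by by_cases h : j = i <;> simp [h])
        simpa using this⟩
    have hlow : ∀ s : ℝ, 0 ≤ s → u ≤ g (fun j => f j 0) + s * c i := fun s hs => by
      simpa [c] using hgS _ (hmem s hs)
    have h0 := hlow 0 le_rfl
    have h1 := hlow ((u - g (fun j => f j 0) - 1) / c i)
      (div_nonneg_of_nonpos (by linarith) hneg.le)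
    rw [div_mul_cancel₀ _ hneg.ne] at h1
    linarith
  have hupper : ∀ s < δ, s * ∑ i, c i < u := fun s hs => by
    have h := hgU (fun _ => s) fun _ _ => hs
    rwa [hg, ← Finset.mul_sum] at h
  have hSsum : ∀ x, u ≤ ∑ i, f i x * c i := fun x => by
    have h := hgS (fun i => f i x) ⟨x, fun i => le_rfl⟩
    rwa [hg] at h
  have hu : 0 < u := by simpa using hupper 0 hδ
  have hsum : 0 < ∑ i, c i := by
    refine (Finset.sum_nonneg fun i _ => hc i).lt_of_ne fun h => ?_
    have hz := (Finset.sum_eq_zero_iff_of_nonneg fun i _ => hc i).mp h.symm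
    have h0 := hSsum 0
    rw [Finset.sum_eq_zero fun i hi => by rw [hz i hi, mul_zero]] at h0
    linarith
  have hbary := sum_inner_centerMass_nonpos hyv w μ (c := fun i => c i / ∑ j, c j)
    (fun i => div_nonneg (hc i) hsum.le) (by rw [← Finset.sum_div, div_self hsum.ne'])
  have hle := hSsum (∑ j, (c j / ∑ l, c l) • y j)
  have heq : ∑ i, f i (∑ j, (c j / ∑ l, c l) • y j) * c i
      = (∑ l, c l) * ∑ i, (c i / ∑ l, c l) * f i (∑ j, (c j / ∑ l, c l) • y j) := by
    rw [Finset.mul_sum]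
    refine Finset.sum_congr rfl fun i _ => ?_
    field_simp
  rw [heq] at hle
  linarith [mul_nonpos_of_nonneg_of_nonpos hsum.le hbary]

/-- Coercivity: `μ‖x - y‖²` eventually dominates the term linear in `x - y`. -/
theorem isCompact_setOf_inner_le [FiniteDimensional ℝ X] (w y v : X) {μ : ℝ} (hμ : 0 < μ) (δ : ℝ) :
    IsCompact {x : X | inner ℝ (v + μ • (x - w)) (x - y) ≤ δ} := by
  refine Metric.isCompact_of_isClosed_isBounded
    (isClosed_le (by fun_prop) continuous_const) ?_
  set a := v + μ • (y - w)
  refine (Metric.isBounded_closedBall (x := y) (r := (‖a‖ + |δ|) / μ + 1)).subset fun x hx => ?_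
  rw [mem_closedBall_iff_norm]
  by_contra! hlt
  have hexp : inner ℝ (v + μ • (x - w)) (x - y) = inner ℝ a (x - y) + μ * ‖x - y‖ ^ 2 := by
    have : v + μ • (x - w) = a + μ • (x - y) := by simp only [a]; module
    rw [this, inner_add_left, real_inner_smul_left, real_inner_self_eq_norm_sq]
  have hcs := (abs_le.mp (abs_real_inner_le_norm a (x - y))).1
  have hx' : inner ℝ a (x - y) + μ * ‖x - y‖ ^ 2 ≤ δ := hexp ▸ hx
  have h0 : 0 ≤ (‖a‖ + |δ|) / μ := by positivity
  have hμr : ‖a‖ + |δ| < μ * ‖x - y‖ := by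
    have := mul_lt_mul_of_pos_left (show (‖a‖ + |δ|) / μ < ‖x - y‖ by linarith) hμ
    rwa [mul_div_cancel₀ _ hμ.ne'] at this
  have h1 : 1 < ‖x - y‖ := by linarith
  have h2 : (‖a‖ + |δ|) * ‖x - y‖ < μ * ‖x - y‖ * ‖x - y‖ :=
    mul_lt_mul_of_pos_right hμr (by linarith)
  have h3 : |δ| ≤ |δ| * ‖x - y‖ := le_mul_of_one_le_right (abs_nonneg δ) h1.le
  nlinarith [le_abs_self δ]

/-- Minty's theorem: in finite dimension, the regularization `B + μ(· - w)` of a maximal monotone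
operator has a zero. -/
theorem IsMaximalMonotone.exists_mem_neg_smul [FiniteDimensional ℝ X] {B : X → Set X}
    (hB : IsMaximalMonotone B) (hne : (graph B).Nonempty) (w : X) {μ : ℝ} (hμ : 0 < μ) :
    ∃ x, -(μ • (x - w)) ∈ B x := by
  classical
  obtain ⟨p₀, hp₀⟩ := hne
  -- The tolerance is part of the index because the finite lemma is only approximate; a finite
  -- subfamily is met using its smallest tolerance.
  let K : graph B × Set.Ioi (0 : ℝ) → Set X := fun i =>
    {x | inner ℝ (i.1.1.2 + μ • (x - w)) (x - i.1.1.1) ≤ i.2.1}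
  have hK : ∀ i, IsCompact (K i) := fun i => isCompact_setOf_inner_le w _ _ hμ _
  have hfin : ∀ t : Finset (graph B × Set.Ioi (0 : ℝ)),
      (K (⟨p₀, hp₀⟩, ⟨1, Set.mem_Ioi.mpr one_pos⟩) ∩ ⋂ i ∈ t, K i).Nonempty := by
    intro t
    let s := insert ((⟨p₀, hp₀⟩, ⟨1, Set.mem_Ioi.mpr one_pos⟩) : graph B × Set.Ioi (0 : ℝ)) t
    obtain ⟨m, -, hm⟩ := s.exists_min_image (fun i => i.2.1) (Finset.insert_nonempty _ _)
    obtain ⟨x, hx⟩ := exists_forall_inner_lt (ι := s) (y := fun i => i.1.1.1.1)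
      (v := fun i => i.1.1.1.2) (fun i j => hB.1 _ i.1.1.2 _ j.1.1.2) w hμ.le m.2.2
    have hmem : ∀ i ∈ s, x ∈ K i := fun i hi => ((hx ⟨i, hi⟩).trans_le (hm i hi)).le
    exact ⟨x, hmem _ (Finset.mem_insert_self _ _),
      Set.mem_iInter₂.mpr fun i hi => hmem i (Finset.mem_insert_of_mem hi)⟩
  obtain ⟨x, -, hx⟩ := (hK (⟨p₀, hp₀⟩, ⟨1, Set.mem_Ioi.mpr one_pos⟩)).inter_iInter_nonempty K
    (fun i => (hK i).isClosed) hfin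
  have hrel : ∀ q ∈ graph B, 0 ≤ inner ℝ (-(μ • (x - w)) - q.2) (x - q.1) := by
    intro q hq
    have hle : inner ℝ (q.2 + μ • (x - w)) (x - q.1) ≤ 0 :=
      le_of_forall_pos_le_add fun δ hδ =>
        (zero_add δ).symm ▸ Set.mem_iInter.mp hx (⟨q, hq⟩, ⟨δ, hδ⟩)
    have hneg : -(μ • (x - w)) - q.2 = -(q.2 + μ • (x - w)) := by abel
    rw [hneg, inner_neg_left]
    linarith
  refine ⟨x, ?_⟩
  -- The new pair is monotonically related to the whole graph, so adjoining it keeps monotonicity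
  -- and maximality absorbs it.
  let B' : X → Set X := fun z => B z ∪ {v | z = x ∧ v = -(μ • (x - w))}
  have hB' : IsMonotone B' := by
    rintro ⟨p, v⟩ (hp | ⟨hp, hv⟩) ⟨q, u⟩ (hq | ⟨hq, hu⟩)
    · exact hB.1 _ hp _ hq
    · have h := hrel _ hp
      simp only at hq hu
      subst hq hu
      rw [← inner_neg_neg] at h
      simpa only [neg_sub, sub_neg_eq_add] using h
    · simp only at hp hv
      subst hp hv
      exact hrel _ hq
    · simp_all
  have hBB' := hB.2 B' hB' fun p hp => Or.inl hp
  rw [hBB']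
  exact Or.inr ⟨rfl, rfl⟩

end Minty

/-! ### Estimates for a single step, relative to the regularized zero `z`. -/

section HPE

variable {X : Type*} [NormedAddCommGroup X] [InnerProductSpace ℝ X] {B : X → Set X}
  {x₀ : X} {σ μ : ℝ}

/-- For a zero `s` of `B`, monotonicity gives `⟪x₀ - z, z - s⟫ ≥ 0`: the angle at `z` is not acute,
so `x₀` is no closer to `s` than to `z`. -/
theorem IsMonotone.norm_sub_le_infDist_zeros (hB : IsMonotone B) (hsol : (zeros B).Nonempty)
    (hμ : 0 < μ) {z : X} (hz : -(μ • (z - x₀)) ∈ B z) : ‖x₀ - z‖ ≤ Metric.infDist x₀ (zeros B) := by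
  refine (Metric.le_infDist hsol).mpr fun s hs => ?_
  have h : 0 ≤ inner ℝ (-(μ • (z - x₀)) - 0) (z - s) := hB (z, _) hz (s, 0) hs
  rw [sub_zero, ← smul_neg, neg_sub, real_inner_smul_left] at h
  have h' : 0 ≤ inner ℝ (x₀ - z) (z - s) := nonneg_of_mul_nonneg_right h hμ
  have hsq : ‖x₀ - s‖ ^ 2 = ‖x₀ - z‖ ^ 2 + 2 * inner ℝ (x₀ - z) (z - s) + ‖z - s‖ ^ 2 := by
    rw [← norm_add_sq_real, sub_add_sub_cancel]
  rw [dist_eq_norm]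
  refine le_of_sq_le_sq ?_ (norm_nonneg _)
  nlinarith [sq_nonneg ‖z - s‖]

section Step

variable {x y b z : X} {lam e : ℝ}

/-- With `a = b + μ(y - x₀)` and `r = λa + y - x`, the squared distance to `z` changes by `‖r‖² - ‖y
- x‖² - 2λ⟪a, y - z⟫`. The enlargement gives `⟪a, y - z⟫ ≥ μ‖y - z‖² - e`, and the resulting `2λe`
is exactly what the error criterion pays for. -/
theorem StepOne.energy_le (h : StepOne B x₀ σ μ x lam y b e) (hz : -(μ • (z - x₀)) ∈ B z) :
    ‖x - lam • (b + μ • (y - x₀)) - z‖ ^ 2 + 2 * lam * μ * ‖y - z‖ ^ 2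
      + (1 - σ ^ 2) * ‖y - x‖ ^ 2 ≤ ‖x - z‖ ^ 2 := by
  have hmem : -e ≤ inner ℝ (b - -(μ • (z - x₀))) (y - z) := h.mem (z, _) hz
  have herr := h.error
  set a := b + μ • (y - x₀) with ha
  have ha' : b - -(μ • (z - x₀)) = a - μ • (y - z) := by rw [ha]; module
  rw [ha', inner_sub_left, real_inner_smul_left, real_inner_self_eq_norm_sq] at hmem
  have h1 : ‖x - lam • a - z‖ ^ 2
      = ‖y - z‖ ^ 2 - 2 * inner ℝ (y - z) (lam • a + y - x) + ‖lam • a + y - x‖ ^ 2 := by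
    rw [← norm_sub_sq_real]
    congr 2
    abel
  have h2 : ‖x - z‖ ^ 2 = ‖y - z‖ ^ 2 - 2 * inner ℝ (y - z) (y - x) + ‖y - x‖ ^ 2 := by
    rw [← norm_sub_sq_real]
    congr 2
    abel
  have h3 : inner ℝ (y - z) (lam • a + y - x)
      = lam * inner ℝ a (y - z) + inner ℝ (y - z) (y - x) := by
    rw [add_sub_assoc, inner_add_right, real_inner_smul_right, real_inner_comm]
  have h4 := mul_le_mul_of_nonneg_left hmem h.lam_pos.le
  nlinarith

theorem StepOne.residual_le (h : StepOne B x₀ σ μ x lam y b e) (hσ0 : 0 ≤ σ) :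
    ‖lam • (b + μ • (y - x₀)) + y - x‖ ≤ σ * ‖y - x‖ := by
  refine le_of_sq_le_sq ?_ (by positivity)
  have := h.error
  have := mul_nonneg h.lam_pos.le h.e_nonneg
  rw [mul_pow]
  linarith

theorem StepOne.norm_sub_sq_le (h : StepOne B x₀ σ μ x lam y b e) (hμ : 0 < μ)
    (hz : -(μ • (z - x₀)) ∈ B z) : (1 - σ ^ 2) * ‖y - x‖ ^ 2 ≤ ‖x - z‖ ^ 2 := by
  have h1 := h.energy_le hz
  have h2 : 0 ≤ 2 * lam * μ * ‖y - z‖ ^ 2 := by have := h.lam_pos; positivity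
  linarith [sq_nonneg ‖x - lam • (b + μ • (y - x₀)) - z‖]

theorem StepOne.eps_le (h : StepOne B x₀ σ μ x lam y b e) (hμ : 0 < μ) (hσ : 0 < 1 - σ ^ 2)
    (hz : -(μ • (z - x₀)) ∈ B z) : 2 * lam * e ≤ σ ^ 2 / (1 - σ ^ 2) * ‖x - z‖ ^ 2 := by
  have h1 := h.norm_sub_sq_le hμ hz
  have h2 := h.error
  calc 2 * lam * e ≤ σ ^ 2 * ‖y - x‖ ^ 2 := by
        linarith [sq_nonneg ‖lam • (b + μ • (y - x₀)) + y - x‖]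
    _ = σ ^ 2 / (1 - σ ^ 2) * ((1 - σ ^ 2) * ‖y - x‖ ^ 2) := by field_simp
    _ ≤ _ := mul_le_mul_of_nonneg_left h1 (by positivity)

theorem StepOne.norm_smul_sq_le (h : StepOne B x₀ σ μ x lam y b e) (hμ : 0 < μ) (hσ0 : 0 ≤ σ)
    (hσ1 : σ < 1) (hz : -(μ • (z - x₀)) ∈ B z) :
    (lam * ‖b + μ • (y - x₀)‖) ^ 2 ≤ (1 + σ) / (1 - σ) * ‖x - z‖ ^ 2 := by
  have h1 := h.norm_sub_sq_le hμ hz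
  have h2 := h.residual_le hσ0
  have hσ : 0 < 1 - σ := by linarith
  set a := b + μ • (y - x₀)
  have h3 : lam * ‖a‖ ≤ (1 + σ) * ‖y - x‖ := by
    have h4 : lam • a = (lam • a + y - x) - (y - x) := by abel
    calc lam * ‖a‖ = ‖lam • a‖ := by rw [norm_smul, Real.norm_of_nonneg h.lam_pos.le]
      _ = ‖(lam • a + y - x) - (y - x)‖ := by rw [← h4]
      _ ≤ ‖lam • a + y - x‖ + ‖y - x‖ := norm_sub_le _ _
      _ ≤ _ := by linarith
  calc (lam * ‖a‖) ^ 2 ≤ ((1 + σ) * ‖y - x‖) ^ 2 :=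
        pow_le_pow_left₀ (mul_nonneg h.lam_pos.le (norm_nonneg _)) h3 2
    _ = (1 + σ) / (1 - σ) * ((1 - σ ^ 2) * ‖y - x‖ ^ 2) := by field_simp; ring
    _ ≤ _ := mul_le_mul_of_nonneg_left h1 (by positivity)

/-- The rate is the minimum of `p u² + q v²` under `u + v = 1`, attained at `p u = q v`; the
triangle inequality through `y` supplies `u` and `v`. -/
theorem StepOne.contraction (h : StepOne B x₀ σ μ x lam y b e) (hμ : 0 < μ)
    (hσ : 0 < 1 - σ ^ 2) (hz : -(μ • (z - x₀)) ∈ B z) {lamLow : ℝ} (hlow : 0 < lamLow)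
    (hlam : lamLow ≤ lam) :
    ‖x - lam • (b + μ • (y - x₀)) - z‖ ^ 2
      ≤ (1 - (1 / (2 * lamLow * μ) + 1 / (1 - σ ^ 2))⁻¹) * ‖x - z‖ ^ 2 := by
  have h1 := h.energy_le hz
  have h2 : 2 * lamLow * μ * ‖y - z‖ ^ 2 ≤ 2 * lam * μ * ‖y - z‖ ^ 2 := by gcongr
  set p := 2 * lamLow * μ with hp
  set q := 1 - σ ^ 2
  have hp0 : 0 < p := by positivity
  have htri : ‖x - z‖ ≤ ‖y - z‖ + ‖y - x‖ := by
    rw [norm_sub_rev y x, add_comm]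
    exact norm_sub_le_norm_sub_add_norm_sub x y z
  have hharm : (1 / p + 1 / q)⁻¹ * ‖x - z‖ ^ 2 ≤ p * ‖y - z‖ ^ 2 + q * ‖y - x‖ ^ 2 := by
    have hinv : (1 / p + 1 / q)⁻¹ = p * q / (p + q) := by field_simp; ring
    calc (1 / p + 1 / q)⁻¹ * ‖x - z‖ ^ 2 ≤ (1 / p + 1 / q)⁻¹ * (‖y - z‖ + ‖y - x‖) ^ 2 := by gcongr
      _ ≤ _ := by
        rw [hinv, div_mul_eq_mul_div, div_le_iff₀ (by positivity)]
        nlinarith [sq_nonneg (p * ‖y - z‖ - q * ‖y - x‖)]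
  linarith

theorem StepOne.norm_sub_zero_le (h : StepOne B x₀ σ μ x lam y b e) (hμ : 0 < μ) (hσ0 : 0 ≤ σ)
    (hσ : 0 < 1 - σ ^ 2) (hz : -(μ • (z - x₀)) ∈ B z) :
    ‖y - z‖ ≤ 1 / √(1 - σ ^ 2) * ‖x - z‖ := by
  have h1 := h.energy_le hz
  have h2 : 0 ≤ 2 * lam * μ * ‖y - z‖ ^ 2 := by have := h.lam_pos; positivity
  have h3 := h.residual_le hσ0
  set a := b + μ • (y - x₀)
  have h4 : ‖y - z‖ ≤ ‖x - lam • a - z‖ + σ * ‖y - x‖ := by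
    have : y - z = (x - lam • a - z) + (lam • a + y - x) := by abel
    calc ‖y - z‖ = ‖(x - lam • a - z) + (lam • a + y - x)‖ := by rw [← this]
      _ ≤ _ := (norm_add_le _ _).trans (by linarith)
  refine le_of_sq_le_sq ?_ (by positivity)
  rw [mul_pow, div_pow, Real.sq_sqrt hσ.le, one_pow, one_div, ← div_eq_inv_mul, le_div_iff₀ hσ]
  calc ‖y - z‖ ^ 2 * (1 - σ ^ 2) ≤ (‖x - lam • a - z‖ + σ * ‖y - x‖) ^ 2 * (1 - σ ^ 2) := by gcongr
    _ ≤ ‖x - lam • a - z‖ ^ 2 + (1 - σ ^ 2) * ‖y - x‖ ^ 2 := by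
      -- The difference of the two sides is exactly this square.
      nlinarith [sq_nonneg (σ * ‖x - lam • a - z‖ - (1 - σ ^ 2) * ‖y - x‖)]
    _ ≤ _ := by linarith

end Step

/-- If a geometrically decaying quantity is still at least `1`, few steps have been made. -/
theorem mul_lt_posLog_of_one_lt {θ C D : ℝ} (hθ : θ ≤ 1) (hCD : C ≤ D) {n : ℕ}
    (h : 1 < C * (1 - θ) ^ n) : θ * n < Real.posLog D := by
  have hpow : 0 ≤ (1 - θ) ^ n := pow_nonneg (by linarith) n
  have hC : 0 < C := by
    by_contra! hC
    linarith [mul_nonpos_of_nonpos_of_nonneg hC hpow]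
  have hexp : (1 - θ) ^ n ≤ Real.exp (-(θ * n)) := by
    calc (1 - θ) ^ n ≤ Real.exp (-θ) ^ n :=
          pow_le_pow_left₀ (by linarith) (Real.one_sub_le_exp_neg θ) n
      _ = _ := by rw [← Real.exp_nat_mul]; ring_nf
  have hlt : Real.exp (θ * n) < D := by
    have h1 : 1 < D * Real.exp (-(θ * n)) :=
      h.trans_le (mul_le_mul hCD hexp hpow (hC.le.trans hCD))
    have h2 := mul_lt_mul_of_pos_right h1 (Real.exp_pos (θ * n))
    rwa [one_mul, mul_assoc, ← Real.exp_add, neg_add_cancel, Real.exp_zero, mul_one] at h2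
  calc θ * n < Real.log D := (Real.lt_log_iff_exp_lt (hC.trans_le hCD)).mpr hlt
    _ ≤ _ := by rw [Real.posLog]; exact le_max_right _ _

/-! ### Iterating the step estimates and counting iterations. -/

namespace Execution

variable {ρ ε : ℝ}

theorem Performs.mono {E : Execution B x₀ σ μ ρ ε} {k j : ℕ} (h : E.Performs k) (hj : 1 ≤ j)
    (hjk : j ≤ k) : E.Performs j :=
  ⟨hj, fun i hi hij => h.2 i hi (hij.trans_le hjk)⟩

theorem one_le_inv_rate (hσ : 0 < 1 - σ ^ 2) {lamLow : ℝ} (hlow : 0 < lamLow) (hμ : 0 < μ) :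
    1 ≤ 1 / (2 * lamLow * μ) + 1 / (1 - σ ^ 2) := by
  have h1 : 1 ≤ 1 / (1 - σ ^ 2) := by
    rw [le_div_iff₀ hσ]
    linarith [sq_nonneg σ]
  have h2 : 0 ≤ 1 / (2 * lamLow * μ) := by positivity
  linarith

/-- The index is shifted because iteration `n + 1` starts from `x n`, which is reached after `n`
contractions. -/
theorem Performs.norm_sq_le {E : Execution B x₀ σ μ ρ ε} (hμ : 0 < μ) (hσ : 0 < 1 - σ ^ 2)
    {z : X} (hz : -(μ • (z - x₀)) ∈ B z) {lamLow : ℝ} (hlow : 0 < lamLow)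
    (hlam : ∀ k, E.Performs k → lamLow ≤ E.lam k) {n : ℕ} (h : E.Performs (n + 1)) :
    ‖E.x n - z‖ ^ 2
      ≤ (1 - (1 / (2 * lamLow * μ) + 1 / (1 - σ ^ 2))⁻¹) ^ n * ‖x₀ - z‖ ^ 2 := by
  induction n with
  | zero => simp [E.x_zero]
  | succ n ih =>
    have hn : E.Performs (n + 1) := h.mono (by omega) (by omega)
    have hstep := E.step_one (n + 1) hn.1 hn.2
    have hupd := E.step_two (n + 1) hn.1 fun j h1 h2 => h.2 j h1 (by omega)
    rw [Nat.add_sub_cancel] at hstep hupd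
    have hθ : (1 / (2 * lamLow * μ) + 1 / (1 - σ ^ 2))⁻¹ ≤ 1 :=
      inv_le_one_of_one_le₀ (one_le_inv_rate hσ hlow hμ)
    rw [hupd, pow_succ' _ n, mul_assoc]
    exact (hstep.contraction hμ hσ hz hlow (hlam _ hn)).trans
      (mul_le_mul_of_nonneg_left (ih hn) (by linarith))

theorem Performs.norm_le {E : Execution B x₀ σ μ ρ ε} (hμ : 0 < μ) (hσ : 0 < 1 - σ ^ 2)
    {z : X} (hz : -(μ • (z - x₀)) ∈ B z) {n : ℕ} (h : E.Performs (n + 1)) :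
    ‖E.x n - z‖ ≤ ‖x₀ - z‖ := by
  induction n with
  | zero => simp [E.x_zero]
  | succ n ih =>
    have hn : E.Performs (n + 1) := h.mono (by omega) (by omega)
    have hstep := E.step_one (n + 1) hn.1 hn.2
    have hupd := E.step_two (n + 1) hn.1 fun j h1 h2 => h.2 j h1 (by omega)
    rw [Nat.add_sub_cancel] at hstep hupd
    refine le_trans ?_ (ih hn)
    have henergy := hstep.energy_le hz
    have h1 : 0 ≤ 2 * E.lam (n + 1) * μ * ‖E.y (n + 1) - z‖ ^ 2 := by
      have := hstep.lam_pos
      positivity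
    have h2 : 0 ≤ (1 - σ ^ 2) * ‖E.y (n + 1) - E.x n‖ ^ 2 := by positivity
    rw [hupd]
    exact le_of_sq_le_sq (by linarith) (norm_nonneg _)

/-- An iteration that does not pass the stopping test occurs early. -/
theorem Performs.mul_lt_of_not_stopTest {E : Execution B x₀ σ μ ρ ε} (hB : IsMonotone B)
    (hsol : (zeros B).Nonempty) (hμ : 0 < μ) (hσ0 : 0 ≤ σ) (hσ1 : σ < 1) (hρ : 0 < ρ) (hε : 0 < ε)
    {z : X} (hz : -(μ • (z - x₀)) ∈ B z) {lamLow : ℝ} (hlow : 0 < lamLow)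
    (hlam : ∀ k, E.Performs k → lamLow ≤ E.lam k) {n : ℕ} (h : E.Performs (n + 1))
    (hns : ¬ StopTest x₀ μ ρ ε (E.y (n + 1)) (E.b (n + 1)) (E.eps (n + 1))) :
    (1 / (2 * lamLow * μ) + 1 / (1 - σ ^ 2))⁻¹ * n < max
      (Real.posLog ((1 + σ) / (1 - σ) *
        (Metric.infDist x₀ (zeros B) ^ 2 / (lamLow ^ 2 * ρ ^ 2))))
      (Real.posLog (σ ^ 2 * Metric.infDist x₀ (zeros B) ^ 2 /
        (2 * (1 - σ ^ 2) * lamLow * ε))) := by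
  have hσ : 0 < 1 - σ ^ 2 := by nlinarith
  have hσ' : 0 < 1 - σ := by linarith
  have hstep := E.step_one (n + 1) h.1 h.2
  rw [Nat.add_sub_cancel] at hstep
  have hlamn := hlam _ h
  have hdec := h.norm_sq_le hμ hσ hz hlow hlam
  have hdist := pow_le_pow_left₀ (norm_nonneg _) (hB.norm_sub_le_infDist_zeros hsol hμ hz) 2
  set d := Metric.infDist x₀ (zeros B)
  have hθ : (1 / (2 * lamLow * μ) + 1 / (1 - σ ^ 2))⁻¹ ≤ 1 :=
    inv_le_one_of_one_le₀ (one_le_inv_rate hσ hlow hμ)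
  set θ := (1 / (2 * lamLow * μ) + 1 / (1 - σ ^ 2))⁻¹
  have hdec' : ‖E.x n - z‖ ^ 2 ≤ d ^ 2 * (1 - θ) ^ n := by
    rw [mul_comm]
    exact hdec.trans (mul_le_mul_of_nonneg_left hdist (pow_nonneg (by linarith) n))
  rw [StopTest, not_and_or, not_le, not_le] at hns
  rcases hns with hns | hns
  · refine lt_max_of_lt_left (mul_lt_posLog_of_one_lt hθ le_rfl ?_)
    have hres := hstep.norm_smul_sq_le hμ hσ0 hσ1 hz
    have hlt : (lamLow * ρ) ^ 2 < (1 + σ) / (1 - σ) * (d ^ 2 * (1 - θ) ^ n) :=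
      calc (lamLow * ρ) ^ 2
          < (E.lam (n + 1) * ‖E.b (n + 1) + μ • (E.y (n + 1) - x₀)‖) ^ 2 :=
            pow_lt_pow_left₀ (mul_lt_mul' hlamn hns hρ.le (hlow.trans_le hlamn))
              (by positivity) two_ne_zero
        _ ≤ _ := hres.trans (mul_le_mul_of_nonneg_left hdec' (by positivity))
    rw [← mul_pow, mul_assoc, div_mul_eq_mul_div (d ^ 2), mul_div_assoc', one_lt_div (by positivity)]
    exact hlt
  · refine lt_max_of_lt_right (mul_lt_posLog_of_one_lt hθ le_rfl ?_)
    have hlt : 2 * lamLow * ε < σ ^ 2 / (1 - σ ^ 2) * (d ^ 2 * (1 - θ) ^ n) :=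
      calc 2 * lamLow * ε < 2 * E.lam (n + 1) * E.eps (n + 1) := by
            have := mul_lt_mul' hlamn hns hε.le (hlow.trans_le hlamn)
            linarith
        _ ≤ _ := (hstep.eps_le hμ hσ hz).trans
            (mul_le_mul_of_nonneg_left hdec' (by positivity))
    rw [div_mul_eq_mul_div, lt_div_iff₀ hσ] at hlt
    rw [div_mul_eq_mul_div, one_lt_div (by positivity)]
    linarith

/-- Either an execution performs the next iteration, or it has stopped. -/
theorem performs_or_exists_stopsAt (E : Execution B x₀ σ μ ρ ε) (n : ℕ) :
    E.Performs (n + 1) ∨ ∃ k ≤ n, E.StopsAt k := by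
  induction n with
  | zero => exact Or.inl ⟨le_rfl, fun j h1 h2 => by omega⟩
  | succ n ih =>
    rcases ih with h | ⟨k, hk, hs⟩
    · by_cases hst : StopTest x₀ μ ρ ε (E.y (n + 1)) (E.b (n + 1)) (E.eps (n + 1))
      · exact Or.inr ⟨n + 1, le_rfl, h, hst⟩
      · refine Or.inl ⟨by omega, fun j h1 h2 => ?_⟩
        rcases (Nat.lt_succ_iff.mp h2).lt_or_eq with hj | rfl
        · exact h.2 j h1 hj
        · exact hst
    · exact Or.inr ⟨k, by omega, hs⟩

theorem exists_stopsAt_le (E : Execution B x₀ σ μ ρ ε) (hB : IsMonotone B)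
    (hsol : (zeros B).Nonempty) (hμ : 0 < μ) (hσ0 : 0 ≤ σ) (hσ1 : σ < 1) (hρ : 0 < ρ) (hε : 0 < ε)
    {z : X} (hz : -(μ • (z - x₀)) ∈ B z) {lamLow : ℝ} (hlow : 0 < lamLow)
    (hlam : ∀ k, E.Performs k → lamLow ≤ E.lam k) :
    ∃ k : ℕ, E.StopsAt k ∧ (k : ℝ) ≤ (1 / (2 * lamLow * μ) + 1 / (1 - σ ^ 2)) * (2 + max
      (Real.posLog ((1 + σ) / (1 - σ) *
        (Metric.infDist x₀ (zeros B) ^ 2 / (lamLow ^ 2 * ρ ^ 2))))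
      (Real.posLog (σ ^ 2 * Metric.infDist x₀ (zeros B) ^ 2 /
        (2 * (1 - σ ^ 2) * lamLow * ε)))) := by
  have hσ : 0 < 1 - σ ^ 2 := by nlinarith
  have hT := one_le_inv_rate hσ hlow hμ
  have hbound := fun (n : ℕ) (h : E.Performs (n + 1)) =>
    h.mul_lt_of_not_stopTest hB hsol hμ hσ0 hσ1 hρ hε hz hlow hlam
  set T := 1 / (2 * lamLow * μ) + 1 / (1 - σ ^ 2)
  set M := max
    (Real.posLog ((1 + σ) / (1 - σ) *
      (Metric.infDist x₀ (zeros B) ^ 2 / (lamLow ^ 2 * ρ ^ 2))))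
    (Real.posLog (σ ^ 2 * Metric.infDist x₀ (zeros B) ^ 2 / (2 * (1 - σ ^ 2) * lamLow * ε)))
  have hM : 0 ≤ M := le_max_of_le_left Real.posLog_nonneg
  have hT0 : 0 < T := by linarith
  have hceil : (⌈T * M⌉₊ : ℝ) < T * M + 1 := Nat.ceil_lt_add_one (by positivity)
  -- Failing the test at iteration `⌈T * M⌉₊ + 1` would force `⌈T * M⌉₊ < T * M`. The count is thus
  -- below `T * M + 2`, and `1 ≤ T` absorbs the `2` into the factor `2 + M`.
  have hfound : ∃ k ≤ ⌈T * M⌉₊ + 1, E.StopsAt k := by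
    rcases E.performs_or_exists_stopsAt ⌈T * M⌉₊ with h | ⟨k, hk, hs⟩
    · refine ⟨_, le_rfl, h, ?_⟩
      by_contra hns
      have hlt := hbound _ h hns
      rw [inv_mul_lt_iff₀ hT0] at hlt
      exact absurd (Nat.le_ceil (T * M)) (not_le.mpr hlt)
    · exact ⟨k, by omega, hs⟩
  obtain ⟨k, hk, hs⟩ := hfound
  refine ⟨k, hs, ?_⟩
  have hk' : (k : ℝ) ≤ ⌈T * M⌉₊ + 1 := by exact_mod_cast hk
  linarith

theorem Performs.norm_y_sub_le {E : Execution B x₀ σ μ ρ ε} (hB : IsMonotone B)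
    (hsol : (zeros B).Nonempty) (hμ : 0 < μ) (hσ0 : 0 ≤ σ) (hσ : 0 < 1 - σ ^ 2)
    {z : X} (hz : -(μ • (z - x₀)) ∈ B z) {n : ℕ} (h : E.Performs (n + 1)) :
    ‖E.y (n + 1) - x₀‖ ≤ (1 + 1 / √(1 - σ ^ 2)) * Metric.infDist x₀ (zeros B) := by
  have hstep := E.step_one (n + 1) h.1 h.2
  rw [Nat.add_sub_cancel] at hstep
  have hd := hB.norm_sub_le_infDist_zeros hsol hμ hz
  have hy : ‖E.y (n + 1) - z‖ ≤ 1 / √(1 - σ ^ 2) * Metric.infDist x₀ (zeros B) :=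
    (hstep.norm_sub_zero_le hμ hσ0 hσ hz).trans
      (mul_le_mul_of_nonneg_left ((h.norm_le hμ hσ hz).trans hd) (by positivity))
  have htri := norm_sub_le_norm_sub_add_norm_sub (E.y (n + 1)) z x₀
  rw [norm_sub_rev z x₀] at htri
  linarith

end Execution

end HPE

end RegHPE

theorem theorem3p3 {X : Type*} [NormedAddCommGroup X] [InnerProductSpace ℝ X]
    [FiniteDimensional ℝ X]
    (B : X → Set X) (hB : RegHPE.IsMaximalMonotone B) (hsol : (RegHPE.zeros B).Nonempty)
    (x₀ : X) (σ : ℝ) (hσ0 : 0 ≤ σ) (hσ1 : σ < 1)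
    (lamLow : ℝ) (hlamLow : 0 < lamLow)
    (ρbar εbar : ℝ) (hρbar : 0 < ρbar) (hεbar : 0 < εbar)
    (ρ : ℝ) (hρ0 : 0 < ρ) (hρ1 : ρ < ρbar) (D₀ : ℝ) (hD₀ : 0 < D₀)
    (E : RegHPE.Execution B x₀ σ (RegHPE.regParam σ ρbar ρ D₀) ρ εbar)
    (hlam : ∀ k, E.Performs k → lamLow ≤ E.lam k) :
    -- (a)
    (∃ k : ℕ, E.StopsAt k ∧
      (k : ℝ) ≤
        ((1 + 1 / Real.sqrt (1 - σ ^ 2)) * D₀ / (2 * lamLow * (ρbar - ρ)) + 1 / (1 - σ ^ 2)) *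
          (2 + max
            (Real.posLog ((1 + σ) / (1 - σ) *
              (Metric.infDist x₀ (RegHPE.zeros B) ^ 2 / (lamLow ^ 2 * ρ ^ 2))))
            (Real.posLog (σ ^ 2 * Metric.infDist x₀ (RegHPE.zeros B) ^ 2 /
              (2 * (1 - σ ^ 2) * lamLow * εbar))))) ∧
    -- (b)
    (Metric.infDist x₀ (RegHPE.zeros B) ≤ D₀ →
      ∃ k : ℕ, E.StopsAt k ∧
        E.b k ∈ RegHPE.enlargement B (E.eps k) (E.y k) ∧
        ‖E.b k‖ ≤ ρbar ∧
        E.eps k ≤ εbar ∧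
        RegHPE.regParam σ ρbar ρ D₀ * ‖E.y k - x₀‖ ≤ ρbar - ρ) := by
  have hσ : 0 < 1 - σ ^ 2 := by nlinarith
  have hc : 0 < 1 + 1 / √(1 - σ ^ 2) := by positivity
  have hμ : 0 < RegHPE.regParam σ ρbar ρ D₀ := div_pos (by linarith) (by positivity)
  obtain ⟨s, hs⟩ := hsol
  obtain ⟨z, hz⟩ := hB.exists_mem_neg_smul ⟨(s, 0), hs⟩ x₀ hμ
  obtain ⟨k, hk, hkle⟩ :=
    E.exists_stopsAt_le hB.1 ⟨s, hs⟩ hμ hσ0 hσ1 hρ0 hεbar hz hlamLow hlam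
  refine ⟨⟨k, hk, ?_⟩, fun hD => ⟨k, hk, (E.step_one k hk.1.1 hk.1.2).mem, ?_⟩⟩
  · have heq : 1 / (2 * lamLow * RegHPE.regParam σ ρbar ρ D₀)
        = (1 + 1 / √(1 - σ ^ 2)) * D₀ / (2 * lamLow * (ρbar - ρ)) := by
      rw [RegHPE.regParam, mul_div_assoc', one_div_div]
    rwa [heq] at hkle
  · have hy : RegHPE.regParam σ ρbar ρ D₀ * ‖E.y k - x₀‖ ≤ ρbar - ρ := by
      have hk1 := hk.1
      obtain ⟨n, rfl⟩ := Nat.exists_eq_add_of_le' hk1.1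
      have hn := (hk1.norm_y_sub_le hB.1 ⟨s, hs⟩ hμ hσ0 hσ hz).trans
        (mul_le_mul_of_nonneg_left hD hc.le)
      refine (mul_le_mul_of_nonneg_left hn hμ.le).trans_eq ?_
      rw [RegHPE.regParam, div_mul_cancel₀ _ (by positivity)]
    refine ⟨?_, hk.2.2, hy⟩
    -- The tolerance `ρbar` splits into `ρ` for the regularized residual and `ρbar - ρ` for the
    -- regularization term.
    have hb : E.b k = (E.b k + RegHPE.regParam σ ρbar ρ D₀ • (E.y k - x₀))
        - RegHPE.regParam σ ρbar ρ D₀ • (E.y k - x₀) := by abel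
    rw [hb]
    refine (norm_sub_le _ _).trans ?_
    rw [norm_smul, Real.norm_of_nonneg hμ.le]
    linarith [hk.2.1]
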